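/- All rings are commutative with $1$. An ideal $D$ of $A$ is dense if $aD=0$, $a\in A$, implies $a=0$. A ring $B\supseteq A$ is a rational extension of $A$ if for all $b,b'\in B$ with $b'\ne 0$ there is $a\in A$ with $ba\in A$ and $b'a\neq 0$; $A$ is rationally complete if it has no proper rational extension. The maximal ring of quotients of $A$ is $\mathcal Q(A)=\varinjlim_D \operatorname{Hom}_A(D,A)$, over all dense ideals $D$ of $A$, with composition as multiplication. For a filter base $\mathcal S$ (closed under finite intersection) of dense subsets of a space $Y$, let $C[\mathcal S]=\varinjlim_{S\in\mathcal S}C(S)$ (real-valued continuous functions, restriction maps), with the metric $d(f,g)=\sup \frac{|f-g|}{1+|f-g|}$, and let $C^*[\mathcal S]$ be its subring of bounded functions. Let $X$ be a completely regular Hausdorff space with Stone–Čech compactification $\beta X$, and let $Q(X)=\mathcal Q(C(X))$, which is canonically $C[\mathcal V_0(X)]$ for $\mathcal V_0(X)$ the family of dense open subsets of $X$. The metric completion $\bar Q(X)$ of $Q(X)$ is a ring by virtue of its realization as $C[\mathcal G_0(\beta X)]$, where $\mathcal G_0(\beta X)$ is the family of dense $G_\delta$-subsets of $\beta X$: there is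 an isometric ring embedding $Q(X)\to C[\mathcal G_0(\beta X)]$ with dense image, compatible with the embeddings of $C(\beta X)=C^*(X)$, and $C[\mathcal G_0(\beta X)]$ is complete. Let $\bar Q^*(X)=C^*[\mathcal G_0(\beta X)]$ be the subring of bounded functions in $\bar Q(X)$. **Theorem.** The ring $\bar Q(X)$ is rationally complete. Hence $\bar Q(X)$ is the maximal ring of quotients of $\bar Q^*(X)$, that is, $\mathcal Q(\bar Q^*(X))\cong\bar Q(X)$ as $\bar Q^*(X)$-algebras; and the bounded part of $\mathcal Q(\bar Q^*(X))$ is $\bar Q^*(X)$: an element of $\mathcal Q(\bar Q^*(X))$ lies in $\bar Q^*(X)$ if and only if it is bounded, i.e. it is represented by some $\varphi\in\operatorname{Hom}(D,\bar Q^*(X))$, $D$ a dense ideal of $\bar Q^*(X)$, for which there is a constant $M$ with $|\varphi(d)|\le M|d|$ pointwise for all $d\in D$ (the function $\varphi(d)/d$ is bounded by $M$). The formal statement includes, as part of its conclusion, the two identifications above ($\mathcal Q(C(X))\cong C[\mathcal V_0(X)]$ over $C(X)$, and $C[\mathcal G_0(\beta X)]$ as the metric completion of $C[\mathcal V_0(X)]$).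 -/

import Mathlib

namespace FGL

/-! ### Rational extensions and the maximal ring of quotients of a commutative ring -/

section Quotients

/-- An ideal is (rationally) dense if its only annihilator in the ring is `0`. -/
def IsDenseIdeal {A : Type*} [CommRing A] (D : Ideal A) : Prop :=
  ∀ a : A, (∀ d ∈ D, a * d = 0) → a = 0

/-- `B`, a ring containing `A`, is a ring of quotients (rational extension) of `A`: for all
`b, b' ∈ B` with `b' ≠ 0` there is `a ∈ A` such that `b a ∈ A` and `b' a ≠ 0`. -/
def IsRationalExtension (A B : Type*) [CommRing A] [CommRing B] [Algebra A B] : Prop :=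
  Function.Injective (algebraMap A B) ∧
    ∀ b b' : B, b' ≠ 0 →
      ∃ a : A, b * algebraMap A B a ∈ Set.range (algebraMap A B) ∧ b' * algebraMap A B a ≠ 0

/-- `A` has no proper rational extension (tested on extensions in an arbitrary universe `v`). -/
def IsRationallyComplete.{u, v} (A : Type u) [CommRing A] : Prop :=
  ∀ (B : Type v) [CommRing B] [Algebra A B],
    IsRationalExtension A B → Function.Surjective (algebraMap A B)

variable (A : Type*) [CommRing A]

/-- The dense ideals of `A`, ordered by reverse inclusion. -/
structure DenseIdeals where
  ideal : Ideal A
  dense : IsDenseIdeal ideal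

instance : Preorder (DenseIdeals A) where
  le D E := E.ideal ≤ D.ideal
  le_refl _ := le_rfl
  le_trans _ _ _ h₁ h₂ := le_trans h₂ h₁

variable {A}

theorem IsDenseIdeal.mul {D E : Ideal A} (hD : IsDenseIdeal D) (hE : IsDenseIdeal E) :
    IsDenseIdeal (D * E) := fun a h =>
  hD a fun d hd => hE (a * d) fun e he => by
    rw [mul_assoc]; exact h _ (Ideal.mul_mem_mul hd he)

theorem isDenseIdeal_top : IsDenseIdeal (⊤ : Ideal A) := fun a h => by
  simpa using h 1 Submodule.mem_top

instance : IsDirectedOrder (DenseIdeals A) where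
  directed D E := 
    ⟨⟨D.ideal * E.ideal, D.dense.mul E.dense⟩,
      Ideal.mul_le_left (I := D.ideal) (J := E.ideal), Ideal.mul_le_right (I := D.ideal) (J := E.ideal)⟩

instance : Nonempty (DenseIdeals A) := ⟨⟨⊤, isDenseIdeal_top⟩⟩

/-- `Hom D`, the `A`-linear maps from the ideal `D` to `A`. -/
abbrev HomIdeal (D : DenseIdeals A) : Type _ := D.ideal →ₗ[A] A

/-- Restriction `Hom D → Hom E` for `E ⊆ D`. -/
def HomIdeal.res (D E : DenseIdeals A) (h : D ≤ E) : HomIdeal D →ₗ[A] HomIdeal E :=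
  LinearMap.lcomp A A (Submodule.inclusion h)

@[simp] theorem HomIdeal.res_apply (D E : DenseIdeals A) (h : D ≤ E) (φ : HomIdeal D) (x : E.ideal) :
    HomIdeal.res D E h φ x = φ ⟨x.1, h x.2⟩ := rfl

instance : DirectedSystem (HomIdeal (A := A)) (HomIdeal.res · · ·) where
  map_self _ _ := rfl
  map_map _ _ _ _ _ _ := rfl

variable (A) in
/-- The maximal ring of quotients of `A`, the direct limit of `Hom D` over all dense ideals `D`. -/
def MaxQuot : Type _ := DirectLimit (HomIdeal (A := A)) HomIdeal.res

namespace MaxQuot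

noncomputable instance : AddCommGroup (MaxQuot A) :=
  inferInstanceAs (AddCommGroup (DirectLimit (HomIdeal (A := A)) HomIdeal.res))

/-- The class of `φ ∈ Hom D`. -/
def mk (D : DenseIdeals A) (φ : HomIdeal D) : MaxQuot A :=
  (⟦⟨D, φ⟩⟧ : DirectLimit (HomIdeal (A := A)) HomIdeal.res)

theorem mk_res {D E : DenseIdeals A} (h : D ≤ E) (φ : HomIdeal D) :
    mk E (HomIdeal.res D E h φ) = mk D φ :=
  DirectLimit.mk_apply (f := HomIdeal.res) D E φ h

theorem mk_eq_of_agree {D E F : DenseIdeals A} (φ : HomIdeal D) (ψ : HomIdeal E)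
    (hD : D ≤ F) (hE : E ≤ F) (h : ∀ x : F.ideal, φ ⟨x.1, hD x.2⟩ = ψ ⟨x.1, hE x.2⟩) :
    mk D φ = mk E ψ := by
  rw [← mk_res hD φ, ← mk_res hE ψ]
  congr 1
  ext x
  exact h x

theorem mk_add (D : DenseIdeals A) (φ ψ : HomIdeal D) : mk D (φ + ψ) = mk D φ + mk D ψ :=
  (DirectLimit.add_def (f := HomIdeal.res) D φ ψ).symm

theorem mk_zero (D : DenseIdeals A) : mk D 0 = 0 :=
  (DirectLimit.zero_def (f := HomIdeal.res) D).symm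

/-- `D · E` as a dense ideal. -/
def prodIdeal (D E : DenseIdeals A) : DenseIdeals A := ⟨D.ideal * E.ideal, D.dense.mul E.dense⟩

theorem map_mem_of_mem_mul {D E : Ideal A} (ψ : E →ₗ[A] A) {x : A} (hx : x ∈ D * E) :
    ψ ⟨x, Ideal.mul_le_right hx⟩ ∈ D := by
  suffices D * E ≤ (Submodule.comap ψ D).map E.subtype by
    obtain ⟨y, hy, rfl⟩ := this hx
    exact hy
  refine Ideal.mul_le.2 fun d hd e he => ⟨d • ⟨e, he⟩, ?_, rfl⟩
  change ψ (d • ⟨e, he⟩) ∈ D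
  rw [map_smul, smul_eq_mul]
  exact Ideal.mul_mem_right _ _ hd

/-- The composite `φ ∘ ψ`, defined on `D · E`. -/
def comp {D E : DenseIdeals A} (φ : HomIdeal D) (ψ : HomIdeal E) : HomIdeal (prodIdeal D E) where
  toFun x := φ ⟨ψ ⟨x.1, Ideal.mul_le_right x.2⟩, map_mem_of_mem_mul ψ x.2⟩
  map_add' x y := by
    rw [← map_add]; congr 1; ext
    exact map_add ψ ⟨x.1, Ideal.mul_le_right x.2⟩ ⟨y.1, Ideal.mul_le_right y.2⟩
  map_smul' a x := by
    rw [RingHom.id_apply, ← map_smul]; congr 1; ext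
    exact map_smul ψ a ⟨x.1, Ideal.mul_le_right x.2⟩

/-- The product is induced by composition. -/
noncomputable instance : Mul (MaxQuot A) where
  mul := DirectLimit.lift₂ HomIdeal.res HomIdeal.res
    (fun D (φ ψ : HomIdeal D) => mk (prodIdeal D D) (comp φ ψ))
    fun D E h φ ψ => mk_eq_of_agree (F := prodIdeal E E) _ _
      (Ideal.mul_mono h h) le_rfl fun _ => rfl

theorem mk_mul_mk (D E : DenseIdeals A) (φ : HomIdeal D) (ψ : HomIdeal E) :
    mk D φ * mk E ψ = mk (prodIdeal D E) (comp φ ψ) := by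
  have hD : D ≤ prodIdeal D E := Ideal.mul_le_left (I := D.ideal) (J := E.ideal)
  have hE : E ≤ prodIdeal D E := Ideal.mul_le_right (I := D.ideal) (J := E.ideal)
  refine (DirectLimit.lift₂_def₂ HomIdeal.res HomIdeal.res _ _ ⟨D, φ⟩ ⟨E, ψ⟩
    (prodIdeal D E) hD hE).trans ?_
  exact mk_eq_of_agree (F := prodIdeal (prodIdeal D E) (prodIdeal D E)) _ _ le_rfl
    (Ideal.mul_mono hD hE) fun _ => rfl

variable (A) in
/-- Multiplication by `a`, as an element of `Hom A`. -/
def mulHom (a : A) : HomIdeal (⟨⊤, isDenseIdeal_top⟩ : DenseIdeals A) :=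
  LinearMap.mulLeft A a ∘ₗ Submodule.subtype _

noncomputable instance : One (MaxQuot A) := ⟨mk _ (mulHom A 1)⟩

theorem ind₁ {p : MaxQuot A → Prop} (h : ∀ D φ, p (mk D φ)) (x) : p x :=
  DirectLimit.induction HomIdeal.res h x

theorem mul_comm' (x y : MaxQuot A) : x * y = y * x := by
  induction x using ind₁ with | _ D φ
  induction y using ind₁ with | _ E ψ
  rw [mk_mul_mk, mk_mul_mk]
  refine mk_eq_of_agree (F := prodIdeal D E) _ _ le_rfl (mul_comm D.ideal E.ideal).le ?_
  rintro ⟨x, hx⟩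
  change φ ⟨ψ ⟨x, Ideal.mul_le_right hx⟩, map_mem_of_mem_mul ψ hx⟩ =
    ψ ⟨φ ⟨x, Ideal.mul_le_left hx⟩, map_mem_of_mem_mul φ (mul_comm D.ideal E.ideal ▸ hx)⟩
  refine Submodule.mul_induction_on'
    (C := fun x hx => φ ⟨ψ ⟨x, Ideal.mul_le_right hx⟩, map_mem_of_mem_mul ψ hx⟩ =
      ψ ⟨φ ⟨x, Ideal.mul_le_left hx⟩, map_mem_of_mem_mul φ (mul_comm D.ideal E.ideal ▸ hx)⟩) ?_ ?_ hx
  · intro d hd e he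
    have hψ : ψ ⟨d * e, Ideal.mul_le_right (Ideal.mul_mem_mul hd he)⟩ = d * ψ ⟨e, he⟩ :=
      map_smul ψ d ⟨e, he⟩
    have hφ : φ ⟨d * e, Ideal.mul_le_left (Ideal.mul_mem_mul hd he)⟩ = e * φ ⟨d, hd⟩ :=
      (congrArg φ (Subtype.ext (mul_comm d e))).trans (map_smul φ e ⟨d, hd⟩)
    have h1 := (congrArg φ (Subtype.ext (hψ.trans (mul_comm _ _)) :
      ⟨_, map_mem_of_mem_mul ψ (Ideal.mul_mem_mul hd he)⟩ = ψ ⟨e, he⟩ • (⟨d, hd⟩ : D.ideal))).trans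
        (map_smul φ (ψ ⟨e, he⟩) ⟨d, hd⟩)
    have h2 := (congrArg ψ (Subtype.ext (hφ.trans (mul_comm _ _)) :
      ⟨_, map_mem_of_mem_mul φ (mul_comm D.ideal E.ideal ▸ Ideal.mul_mem_mul hd he)⟩ =
        φ ⟨d, hd⟩ • (⟨e, he⟩ : E.ideal))).trans (map_smul ψ (φ ⟨d, hd⟩) ⟨e, he⟩)
    exact h1.trans ((mul_comm _ _).trans h2.symm)
  · intro x hx y hy h1 h2
    have e1 := map_add ψ ⟨x, Ideal.mul_le_right hx⟩ ⟨y, Ideal.mul_le_right hy⟩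
    have e2 := map_add φ ⟨x, Ideal.mul_le_left hx⟩ ⟨y, Ideal.mul_le_left hy⟩
    have e3 := map_add φ ⟨ψ ⟨x, Ideal.mul_le_right hx⟩, map_mem_of_mem_mul ψ hx⟩
      ⟨ψ ⟨y, Ideal.mul_le_right hy⟩, map_mem_of_mem_mul ψ hy⟩
    have e4 := map_add ψ
      ⟨φ ⟨x, Ideal.mul_le_left hx⟩, map_mem_of_mem_mul φ (mul_comm D.ideal E.ideal ▸ hx)⟩
      ⟨φ ⟨y, Ideal.mul_le_left hy⟩, map_mem_of_mem_mul φ (mul_comm D.ideal E.ideal ▸ hy)⟩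
    rw [← h1, ← h2, ← e3] at e4
    refine Eq.trans ?_ (e4.symm.trans ?_)
    · congr 1; ext; exact e1
    · congr 1; ext; exact e2.symm

noncomputable instance : CommRing (MaxQuot A) where
  mul_assoc x y z := by
    induction x using ind₁ with | _ D φ
    induction y using ind₁ with | _ E ψ
    induction z using ind₁ with | _ F χ
    simp only [mk_mul_mk]
    exact mk_eq_of_agree (F := prodIdeal (prodIdeal D E) F) _ _ le_rfl
      (mul_assoc D.ideal E.ideal F.ideal).le fun _ => rfl
  mul_comm := mul_comm'
  one_mul x := by
    induction x using ind₁ with | _ D φ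
    refine (mk_mul_mk ..).trans (mk_eq_of_agree (F := prodIdeal _ D) _ _ le_rfl
      Ideal.mul_le_right fun x => ?_)
    exact one_mul (φ ⟨x.1, Ideal.mul_le_right x.2⟩)
  mul_one x := by
    rw [mul_comm']
    induction x using ind₁ with | _ D φ
    refine (mk_mul_mk ..).trans (mk_eq_of_agree (F := prodIdeal _ D) _ _ le_rfl
      Ideal.mul_le_right fun x => ?_)
    exact one_mul (φ ⟨x.1, Ideal.mul_le_right x.2⟩)
  zero_mul x := by
    induction x using ind₁ with | _ D φ
    rw [← mk_zero D, mk_mul_mk]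
    exact (mk_eq_of_agree (F := prodIdeal D D) _ _ le_rfl Ideal.mul_le_right fun _ => rfl)
  mul_zero x := by
    rw [mul_comm']
    induction x using ind₁ with | _ D φ
    rw [← mk_zero D, mk_mul_mk]
    exact (mk_eq_of_agree (F := prodIdeal D D) _ _ le_rfl Ideal.mul_le_right fun _ => rfl)
  left_distrib x y z := by
    rw [mul_comm' x, mul_comm' x, mul_comm' x]
    induction x using ind₁ with | _ D φ
    revert y z
    refine DirectLimit.induction₂ HomIdeal.res fun E ψ χ => ?_
    change (mk E ψ + mk E χ) * mk D φ = mk E ψ * mk D φ + mk E χ * mk D φ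
    rw [← mk_add, mk_mul_mk, mk_mul_mk, mk_mul_mk, ← mk_add]
    rfl
  right_distrib x y z := by
    induction z using ind₁ with | _ D φ
    revert x y
    refine DirectLimit.induction₂ HomIdeal.res fun E ψ χ => ?_
    change (mk E ψ + mk E χ) * mk D φ = mk E ψ * mk D φ + mk E χ * mk D φ
    rw [← mk_add, mk_mul_mk, mk_mul_mk, mk_mul_mk, ← mk_add]
    rfl
  neg_add_cancel := neg_add_cancel
  sub_eq_add_neg := sub_eq_add_neg
  zsmul := zsmulRec
  nsmul := nsmulRec

variable (A) in
/-- The canonical embedding of `A`, sending `a` to multiplication by `a`. -/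
noncomputable def ofRing : A →+* MaxQuot A where
  toFun a := mk _ (mulHom A a)
  map_one' := rfl
  map_mul' a b := by
    rw [mk_mul_mk]
    refine mk_eq_of_agree (F := prodIdeal _ _) _ _ Ideal.mul_le_right le_rfl fun x => ?_
    exact mul_assoc a b x.1
  map_zero' := by
    rw [← mk_zero]; congr 1; ext x; exact zero_mul _
  map_add' a b := by
    rw [← mk_add]; congr 1; ext x; exact add_mul _ _ _

noncomputable instance : Algebra A (MaxQuot A) := (ofRing A).toAlgebra

end MaxQuot

end Quotients

/-! ### The rings `C[𝒮]` of continuous functions on the members of a filter base of dense sets -/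

section Functions

/-- A filter base, closed under finite intersection, of dense subsets of `X`. -/
structure DenseBase (X : Type*) [TopologicalSpace X] where
  sets : Set (Set X)
  nonempty : sets.Nonempty
  dense : ∀ S ∈ sets, Dense S
  inter_mem : ∀ S ∈ sets, ∀ T ∈ sets, S ∩ T ∈ sets

/-- The family of all dense open sets. -/
def denseOpens (X : Type*) [TopologicalSpace X] : DenseBase X where
  sets := {V | IsOpen V ∧ Dense V}
  nonempty := ⟨Set.univ, isOpen_univ, dense_univ⟩
  dense _ h := h.2
  inter_mem _ hS _ hT := ⟨hS.1.inter hT.1, hS.2.inter_of_isOpen_left hT.2 hS.1⟩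

/-- The family of all dense `G_δ`-sets of a Baire space. -/
def denseGδ (X : Type*) [TopologicalSpace X] [BaireSpace X] : DenseBase X where
  sets := {S | IsGδ S ∧ Dense S}
  nonempty := ⟨Set.univ, IsGδ.univ, dense_univ⟩
  dense _ h := h.2
  inter_mem _ hS _ hT := ⟨hS.1.inter hT.1, hS.2.inter_of_Gδ hS.1 hT.1 hT.2⟩

variable {X : Type*} [TopologicalSpace X] (𝒮 : DenseBase X)

/-- The members of `𝒮`, ordered by reverse inclusion. -/
structure DenseBase.Index where
  set : Set X
  mem : set ∈ 𝒮.sets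

instance : Preorder 𝒮.Index where
  le S T := T.set ⊆ S.set
  le_refl _ := subset_rfl
  le_trans _ _ _ h₁ h₂ := h₂.trans h₁

instance : IsDirectedOrder 𝒮.Index where
  directed S T := ⟨⟨S.set ∩ T.set, 𝒮.inter_mem _ S.mem _ T.mem⟩,
    (Set.inter_subset_left : S.set ∩ T.set ⊆ S.set),
    (Set.inter_subset_right : S.set ∩ T.set ⊆ T.set)⟩

instance : Nonempty 𝒮.Index := let ⟨S, hS⟩ := 𝒮.nonempty; ⟨⟨S, hS⟩⟩

variable {𝒮}

/-- `C(S)` for `S ∈ 𝒮`. -/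
abbrev CFun (S : 𝒮.Index) : Type _ := C(S.set, ℝ)

/-- Restriction `C(S) → C(T)` for `T ⊆ S`. -/
def CFun.res (S T : 𝒮.Index) (h : S ≤ T) : CFun S →ₐ[ℝ] CFun T :=
  ContinuousMap.compRightAlgHom ℝ ℝ ⟨Set.inclusion h, continuous_inclusion h⟩

@[simp] theorem CFun.res_apply (S T : 𝒮.Index) (h : S ≤ T) (f : CFun S) (x : T.set) :
    CFun.res S T h f x = f ⟨x.1, h x.2⟩ := rfl

instance : DirectedSystem (CFun (𝒮 := 𝒮)) (CFun.res · · ·) where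
  map_self _ _ := rfl
  map_map _ _ _ _ _ _ := rfl

variable (𝒮) in
/-- The ring `C[𝒮]`, the direct limit of the rings `C(S)`, `S ∈ 𝒮`, under restriction. -/
def CLim : Type _ := DirectLimit (CFun (𝒮 := 𝒮)) CFun.res

namespace CLim

noncomputable instance : CommRing (CLim 𝒮) :=
  inferInstanceAs (CommRing (DirectLimit (CFun (𝒮 := 𝒮)) CFun.res))

/-- The class of `f ∈ C(S)`. -/
def mk (S : 𝒮.Index) (f : C(S.set, ℝ)) : CLim 𝒮 :=
  (⟦⟨S, f⟩⟧ : DirectLimit (CFun (𝒮 := 𝒮)) CFun.res)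

theorem mk_res {S T : 𝒮.Index} (h : S ≤ T) (f : CFun S) : mk T (CFun.res S T h f) = mk S f :=
  DirectLimit.mk_apply (f := CFun.res) S T f h

theorem mk_add (S : 𝒮.Index) (f g : C(S.set, ℝ)) : mk S (f + g) = mk S f + mk S g :=
  (DirectLimit.add_def (G := CFun) (f := CFun.res) S f g).symm

theorem mk_mul (S : 𝒮.Index) (f g : C(S.set, ℝ)) : mk S (f * g) = mk S f * mk S g :=
  (DirectLimit.mul_def (G := CFun) (f := CFun.res) S f g).symm

theorem mk_one (S : 𝒮.Index) : mk S 1 = 1 := (DirectLimit.one_def (f := CFun.res) S).symm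

theorem mk_zero (S : 𝒮.Index) : mk S 0 = 0 := (DirectLimit.zero_def (f := CFun.res) S).symm

theorem mk_neg (S : 𝒮.Index) (f : C(S.set, ℝ)) : mk S (-f) = -mk S f :=
  (DirectLimit.neg_def (G := CFun) (f := CFun.res) S f).symm

theorem mk_sub (S : 𝒮.Index) (f g : C(S.set, ℝ)) : mk S (f - g) = mk S f - mk S g := by
  rw [sub_eq_add_neg, mk_add, mk_neg, ← sub_eq_add_neg]

theorem ind₁ {p : CLim 𝒮 → Prop} (h : ∀ S f, p (mk S f)) (x) : p x :=
  DirectLimit.induction CFun.res h x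

theorem ind₂ {p : CLim 𝒮 → CLim 𝒮 → Prop} (h : ∀ S f g, p (mk S f) (mk S g)) (x y) : p x y :=
  DirectLimit.induction₂ CFun.res h x y

theorem ind₃ {p : CLim 𝒮 → CLim 𝒮 → CLim 𝒮 → Prop}
    (h : ∀ S f g k, p (mk S f) (mk S g) (mk S k)) (x y z) : p x y z :=
  DirectLimit.induction₃ CFun.res h x y z

variable (𝒮) in
/-- The restriction homomorphism `C(X) → C[𝒮]`. -/
noncomputable def ofC : C(X, ℝ) →+* CLim 𝒮 :=
  let S : 𝒮.Index := Classical.arbitrary _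
  { toFun := fun f => mk S (f.restrict S.set)
    map_one' := mk_one S
    map_mul' := fun f g => mk_mul S (f.restrict S.set) (g.restrict S.set)
    map_zero' := mk_zero S
    map_add' := fun f g => mk_add S (f.restrict S.set) (g.restrict S.set) }

theorem ofC_eq (S : 𝒮.Index) (f : C(X, ℝ)) : ofC 𝒮 f = mk S (f.restrict S.set) := by
  obtain ⟨T, h₁, h₂⟩ := exists_ge_ge (Classical.arbitrary 𝒮.Index) S
  change mk _ _ = _
  rw [← mk_res h₁, ← mk_res h₂]
  rfl

noncomputable instance : Algebra C(X, ℝ) (CLim 𝒮) := (ofC 𝒮).toAlgebra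

/-- `|a| ≤ M |b|` pointwise, for functions `a, b ∈ C[𝒮]`. -/
def AbsLE (M : ℝ) (a b : CLim 𝒮) : Prop :=
  ∃ (S : 𝒮.Index) (f g : C(S.set, ℝ)), a = mk S f ∧ b = mk S g ∧ ∀ s, |f s| ≤ M * |g s|

variable (𝒮) in
/-- The subring `C*[𝒮]` of bounded functions in `C[𝒮]`. -/
def bounded : Subring (CLim 𝒮) where
  carrier := {a | ∃ M : ℝ, ∃ (S : 𝒮.Index) (f : C(S.set, ℝ)), a = mk S f ∧ ∀ s, |f s| ≤ M}
  mul_mem' := by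
    rintro a b ⟨M, S, f, rfl, hf⟩ ⟨N, T, g, rfl, hg⟩
    obtain ⟨U, hS, hT⟩ := exists_ge_ge S T
    refine ⟨|M| * |N|, U, CFun.res S U hS f * CFun.res T U hT g, ?_, fun s => ?_⟩
    · rw [mk_mul, mk_res, mk_res]
    · rw [ContinuousMap.mul_apply, abs_mul]
      exact mul_le_mul ((hf _).trans (le_abs_self M)) ((hg _).trans (le_abs_self N))
        (abs_nonneg _) (abs_nonneg _)
  one_mem' := ⟨1, Classical.arbitrary _, 1, (mk_one _).symm, fun s => by simp⟩
  add_mem' := by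
    rintro a b ⟨M, S, f, rfl, hf⟩ ⟨N, T, g, rfl, hg⟩
    obtain ⟨U, hS, hT⟩ := exists_ge_ge S T
    refine ⟨M + N, U, CFun.res S U hS f + CFun.res T U hT g, ?_, fun s => ?_⟩
    · rw [mk_add, mk_res, mk_res]
    · exact (abs_add_le _ _).trans (add_le_add (hf _) (hg _))
  zero_mem' := ⟨0, Classical.arbitrary _, 0, (mk_zero _).symm, fun s => by simp⟩
  neg_mem' := by
    rintro a ⟨M, S, f, rfl, hf⟩
    exact ⟨M, S, -f, (mk_neg S f).symm, fun s => by simpa using hf s⟩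

/-! The metric of `C[𝒮]`: the distance of `f` and `g` is the supremum of
`|f - g| / (1 + |f - g|)`. -/

theorem div_one_add_lt (t : ℝ) : |t| / (1 + |t|) ≤ 1 :=
  (div_le_one (by positivity)).2 (by linarith)

theorem bddAbove_size {Y : Type*} (f : Y → ℝ) :
    BddAbove (Set.range fun s => |f s| / (1 + |f s|)) :=
  ⟨1, by rintro _ ⟨s, rfl⟩; exact div_one_add_lt _⟩

/-- The sup norm of `|f| / (1 + |f|)`. -/
noncomputable def sizeFun {Y : Type*} [TopologicalSpace Y] (f : C(Y, ℝ)) : ℝ :=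
  ⨆ s, |f s| / (1 + |f s|)

theorem sizeFun_res {S T : 𝒮.Index} (h : S ≤ T) (f : CFun S) :
    sizeFun f = sizeFun (CFun.res S T h f) := by
  have hnn : 0 ≤ sizeFun (CFun.res S T h f) := Real.iSup_nonneg fun s => by positivity
  apply le_antisymm
  · refine Real.iSup_le (fun s => ?_) hnn
    have hd : Dense (Set.range (Set.inclusion h)) := by
      rw [Subtype.dense_iff]
      intro x _
      have : ((↑) : S.set → X) '' Set.range (Set.inclusion h) = T.set := by
        ext y; constructor
        · rintro ⟨_, ⟨z, rfl⟩, rfl⟩; exact z.2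
        · intro hy; exact ⟨_, ⟨⟨y, hy⟩, rfl⟩, rfl⟩
      rw [this]; exact 𝒮.dense _ T.mem x
    have hc : IsClosed {s : S.set | |f s| / (1 + |f s|) ≤ sizeFun (CFun.res S T h f)} := by
      refine isClosed_le (Continuous.div (by fun_prop) (by fun_prop) fun s => ?_) continuous_const
      positivity
    have hsub : Set.range (Set.inclusion h) ⊆
        {s : S.set | |f s| / (1 + |f s|) ≤ sizeFun (CFun.res S T h f)} := by
      rintro _ ⟨z, rfl⟩
      exact le_ciSup (bddAbove_size (CFun.res S T h f)) z
    exact hc.closure_subset_iff.2 hsub (hd s)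
  · refine Real.iSup_le (fun s => ?_) (Real.iSup_nonneg fun s => by positivity)
    exact le_ciSup (bddAbove_size f) (⟨s.1, h s.2⟩ : S.set)

/-- The sup norm of `|a| / (1 + |a|)` for `a ∈ C[𝒮]`, computed on any representative. -/
noncomputable def size : CLim 𝒮 → ℝ :=
  DirectLimit.lift CFun.res (fun _ f => sizeFun f) fun _ _ h f => sizeFun_res h f

theorem size_mk (S : 𝒮.Index) (f : C(S.set, ℝ)) : size (mk S f) = sizeFun f := rfl

theorem le_sizeFun {Y : Type*} [TopologicalSpace Y] (f : C(Y, ℝ)) (s : Y) :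
    |f s| / (1 + |f s|) ≤ sizeFun f := le_ciSup (bddAbove_size f) s

theorem div_one_add_add_le {a b c : ℝ} (h : |a| ≤ |b| + |c|) :
    |a| / (1 + |a|) ≤ |b| / (1 + |b|) + |c| / (1 + |c|) := by
  have ha := abs_nonneg a
  have hb := abs_nonneg b
  have hc := abs_nonneg c
  rw [div_add_div _ _ (by positivity) (by positivity), div_le_div_iff₀ (by positivity)
    (by positivity)]
  nlinarith [mul_nonneg hb hc, mul_nonneg ha hb, mul_nonneg ha hc, mul_nonneg (mul_nonneg ha hb) hc]

noncomputable instance : MetricSpace (CLim 𝒮) where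
  dist a b := size (a - b)
  dist_self a := by
    induction a using ind₁ with | _ S f
    rw [sub_self, ← mk_zero S, size_mk]
    simp [sizeFun]
  dist_comm a b := by
    revert a b
    refine ind₂ fun S f g => ?_
    rw [← mk_sub, ← mk_sub, size_mk, size_mk]
    simp [sizeFun, abs_sub_comm]
  dist_triangle a b c := by
    revert a b c
    refine ind₃ fun S f g k => ?_
    rw [← mk_sub, ← mk_sub, ← mk_sub, size_mk, size_mk, size_mk]
    refine Real.iSup_le (fun s => ?_) (add_nonneg (Real.iSup_nonneg fun s => by positivity)
      (Real.iSup_nonneg fun s => by positivity))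
    exact (div_one_add_add_le (abs_sub_le (f s) (g s) (k s))).trans
      (add_le_add (le_sizeFun (f - g) s) (le_sizeFun (g - k) s))
  eq_of_dist_eq_zero := by
    refine fun {a b} => @ind₂ _ _ _ (fun a b => size (a - b) = 0 → a = b) (fun S f g h => ?_) a b
    rw [← mk_sub, size_mk] at h
    congr 1
    ext s
    have h1 := le_sizeFun (f - g) s
    rw [h] at h1
    have h2 : 0 ≤ |(f - g) s| := abs_nonneg _
    have h3 : |(f - g) s| = 0 := by
      by_contra hne
      have : 0 < |(f - g) s| / (1 + |(f - g) s|) := by positivity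
      linarith
    exact sub_eq_zero.1 (abs_eq_zero.1 h3)

end CLim

/-- An element `q` of the maximal ring of quotients of `C*[𝒮]` is a bounded function: `q` is the
class of some `φ ∈ Hom D`, i.e. it is the function whose value is `φ(d) / d` where `d ∈ D` does not
vanish, and `|φ(d) / d| ≤ M` for a constant `M`. -/
def IsBoundedQuotient (q : MaxQuot (CLim.bounded 𝒮)) : Prop :=
  ∃ (D : DenseIdeals (CLim.bounded 𝒮)) (φ : HomIdeal D) (M : ℝ), q = MaxQuot.mk D φ ∧
    ∀ d : D.1, CLim.AbsLE M (φ d : CLim 𝒮) ((d : CLim.bounded 𝒮) : CLim 𝒮)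

end Functions

/-- `Q(X)`, realised as the ring of continuous functions on the dense open subsets of `X`. -/
abbrev Q (X : Type*) [TopologicalSpace X] : Type _ := CLim (denseOpens X)

/-- The completion of `Q(X)`, realised as the ring of continuous functions on the dense
`G_δ`-subsets of the Stone-Čech compactification of `X`. -/
abbrev QBar (X : Type*) [TopologicalSpace X] : Type _ := CLim (denseGδ (StoneCech X))

/-- The subring of bounded functions in the completion of `Q(X)`. -/
noncomputable abbrev QBarStar (X : Type*) [TopologicalSpace X] : Subring (QBar X) :=
  CLim.bounded (denseGδ (StoneCech X))

end FGL

universe u v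

/-!
A rational extension `B` of `A` embeds into the maximal ring of quotients of `A`, an element `b`
acting by multiplication on the dense ideal of those `a` with `b a ∈ A`. This embedding is onto if
`B` is rationally complete, as `𝒬(A)` is then a rational extension of `B`.

Let `φ` be a homomorphism from a dense ideal `D` of `C[𝒮]` to `C[𝒮]`. By density of `D`, the sets on
which some `d ∈ D` does not vanish have dense union, so they can be shrunk to pairwise disjoint
open sets whose union is still dense. The quotients `φ(d) / d` on these sets are glued to a single
function, and `φ` is multiplication by it: `C[𝒮]` is rationally complete for the dense open sets as
well as for the dense `G_δ`-sets. Every `b` is brought into the bounded subring by the denominator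
`1 / (1 + b²)`, hence `C[𝒮]` is also the maximal ring of quotients of `C*[𝒮]`.

A continuous function `f` on a dense open subset of `X` extends to the points of continuity of
`y ↦ limsup f` on `βX`, which form a `G_δ`-set. Conversely, a continuous function on a dense
`G_δ`-set is approximated uniformly by locally constant functions on dense open sets.
-/

namespace FGL

open Function Set Filter Topology

section MaximalQuotients

theorem HomIdeal.mul_apply_comm {A : Type*} [CommRing A] {D : DenseIdeals A} (φ : HomIdeal D)
    (d e : D.ideal) : (d : A) * φ e = e * φ d := by
  rw [← smul_eq_mul, ← smul_eq_mul, ← map_smul, ← map_smul]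
  exact congrArg φ (Subtype.ext (mul_comm _ _))

namespace MaxQuot

variable {A : Type*} [CommRing A]

theorem exists_agree_of_mk_eq {D E : DenseIdeals A} {φ : HomIdeal D} {ψ : HomIdeal E}
    (h : mk D φ = mk E ψ) :
    ∃ (F : DenseIdeals A) (hD : D ≤ F) (hE : E ≤ F),
      ∀ x : F.ideal, φ ⟨x.1, hD x.2⟩ = ψ ⟨x.1, hE x.2⟩ := by
  obtain ⟨F, hD, hE, h⟩ := Quotient.exact h
  exact ⟨F, hD, hE, LinearMap.congr_fun h⟩

theorem algebraMap_injective : Injective (algebraMap A (MaxQuot A)) := by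
  intro a b hab
  obtain ⟨F, _, _, hF⟩ := exists_agree_of_mk_eq hab
  refine sub_eq_zero.1 (F.dense _ fun d hd => ?_)
  rw [sub_mul, sub_eq_zero]
  exact hF ⟨d, hd⟩

theorem mk_mul_algebraMap {D : DenseIdeals A} (φ : HomIdeal D) (d : D.ideal) :
    mk D φ * algebraMap A (MaxQuot A) d = algebraMap A (MaxQuot A) (φ d) := by
  refine (mk_mul_mk ..).trans
    (mk_eq_of_agree (F := prodIdeal D _) _ _ le_rfl Ideal.mul_le_right fun x => ?_)
  have hx : x.1 ∈ D.ideal := Ideal.mul_le_left x.2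
  have hdx : φ ((d : A) • ⟨x.1, hx⟩) = x.1 * φ d := by
    rw [map_smul, smul_eq_mul, HomIdeal.mul_apply_comm]
  exact hdx.trans (mul_comm _ _)

end MaxQuot

variable {A : Type*} [CommRing A]

theorem isRationalExtension_maxQuot : IsRationalExtension A (MaxQuot A) := by
  refine ⟨MaxQuot.algebraMap_injective, fun q q' hq' => ?_⟩
  induction q using MaxQuot.ind₁ with | _ D φ
  induction q' using MaxQuot.ind₁ with | _ E ψ
  by_contra! hann
  have hzero (x : (MaxQuot.prodIdeal D E).ideal) : ψ ⟨x.1, Ideal.mul_le_right x.2⟩ = 0 := by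
    have hx := hann x.1 ⟨_, (MaxQuot.mk_mul_algebraMap φ ⟨x.1, Ideal.mul_le_left x.2⟩).symm⟩
    rw [MaxQuot.mk_mul_algebraMap ψ ⟨x.1, Ideal.mul_le_right x.2⟩] at hx
    exact MaxQuot.algebraMap_injective (hx.trans (map_zero _).symm)
  refine hq' ((MaxQuot.mk_eq_of_agree (F := MaxQuot.prodIdeal D E) ψ (0 : HomIdeal E)
    Ideal.mul_le_right Ideal.mul_le_right hzero).trans (MaxQuot.mk_zero E))

variable {B : Type*} [CommRing B] [Algebra A B]

variable (A) in
/-- The ideal `(A : b) = {a ∈ A | b a ∈ A}` of denominators of an element `b` of an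
extension of `A`. -/
def denominators (b : B) : Ideal A :=
  (LinearMap.range (Algebra.linearMap A B)).comap (LinearMap.mulLeft A b ∘ₗ Algebra.linearMap A B)

namespace IsRationalExtension

theorem eq_zero_of_forall_mul_eq_zero (h : IsRationalExtension A B) {D : Ideal A}
    (hD : IsDenseIdeal D) {b : B} (hb : ∀ d ∈ D, b * algebraMap A B d = 0) : b = 0 := by
  by_contra hne
  obtain ⟨a, ⟨c, hc⟩, ha⟩ := h.2 b b hne
  refine ha ?_
  rw [← hc, hD c fun d hd => h.1 ?_, map_zero]
  rw [map_mul, hc, mul_right_comm, hb d hd, zero_mul, map_zero]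

theorem eq_of_forall_mul_eq (h : IsRationalExtension A B) {D : Ideal A} (hD : IsDenseIdeal D)
    {b c : B} (hbc : ∀ d ∈ D, b * algebraMap A B d = c * algebraMap A B d) : b = c :=
  sub_eq_zero.1 <| h.eq_zero_of_forall_mul_eq_zero hD fun d hd => by
    rw [sub_mul, hbc d hd, sub_self]

theorem isDenseIdeal_denominators (h : IsRationalExtension A B) (b : B) :
    IsDenseIdeal (denominators A b) := by
  intro a ha
  by_contra hne
  obtain ⟨d, hd, had⟩ := h.2 b (algebraMap A B a) ((map_ne_zero_iff _ h.1).2 hne)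
  rw [← map_mul, ha d hd, map_zero] at had
  exact had rfl

/-- Multiplication by `b`, as a homomorphism from the denominators of `b` to `A`. -/
noncomputable def mulDenominators (h : IsRationalExtension A B) (b : B) :
    denominators A b →ₗ[A] A :=
  (LinearEquiv.ofInjective (Algebra.linearMap A B) h.1).symm.toLinearMap ∘ₗ
    (LinearMap.mulLeft A b ∘ₗ Algebra.linearMap A B).restrict fun _ ha => ha

theorem algebraMap_mulDenominators (h : IsRationalExtension A B) (b : B) (d : denominators A b) :
    algebraMap A B (h.mulDenominators b d) = b * algebraMap A B d :=
  congrArg Subtype.val <|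
    (LinearEquiv.ofInjective (Algebra.linearMap A B) h.1).apply_symm_apply ⟨_, d.2⟩

theorem mk_mulDenominators_eq (h : IsRationalExtension A B) {b : B} {D : DenseIdeals A}
    {φ : HomIdeal D} (hφ : ∀ d : D.ideal, b * algebraMap A B d = algebraMap A B (φ d)) :
    MaxQuot.mk ⟨denominators A b, h.isDenseIdeal_denominators b⟩ (h.mulDenominators b) =
      MaxQuot.mk D φ :=
  MaxQuot.mk_eq_of_agree (F := D) _ _ (fun d hd => ⟨φ ⟨d, hd⟩, (hφ ⟨d, hd⟩).symm⟩) le_rfl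
    fun d => h.1 ((h.algebraMap_mulDenominators b _).trans (hφ d))

theorem mk_mulDenominators_add (h : IsRationalExtension A B) (b c : B) :
    MaxQuot.mk ⟨_, h.isDenseIdeal_denominators (b + c)⟩ (h.mulDenominators (b + c)) =
      MaxQuot.mk ⟨_, h.isDenseIdeal_denominators b⟩ (h.mulDenominators b) +
        MaxQuot.mk ⟨_, h.isDenseIdeal_denominators c⟩ (h.mulDenominators c) := by
  obtain ⟨F, hb, hc⟩ := exists_ge_ge (⟨_, h.isDenseIdeal_denominators b⟩ : DenseIdeals A)
    ⟨_, h.isDenseIdeal_denominators c⟩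
  rw [← MaxQuot.mk_res hb, ← MaxQuot.mk_res hc, ← MaxQuot.mk_add]
  refine h.mk_mulDenominators_eq fun d => ?_
  rw [LinearMap.add_apply, HomIdeal.res_apply, HomIdeal.res_apply, map_add,
    algebraMap_mulDenominators, algebraMap_mulDenominators, add_mul]

theorem mk_mulDenominators_mul (h : IsRationalExtension A B) (b c : B) :
    MaxQuot.mk ⟨_, h.isDenseIdeal_denominators (b * c)⟩ (h.mulDenominators (b * c)) =
      MaxQuot.mk ⟨_, h.isDenseIdeal_denominators b⟩ (h.mulDenominators b) *
        MaxQuot.mk ⟨_, h.isDenseIdeal_denominators c⟩ (h.mulDenominators c) := by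
  rw [MaxQuot.mk_mul_mk]
  refine h.mk_mulDenominators_eq fun d => ?_
  rw [MaxQuot.comp, LinearMap.coe_mk, AddHom.coe_mk, algebraMap_mulDenominators,
    algebraMap_mulDenominators, mul_assoc]

theorem mk_mulDenominators_eq_algebraMap (h : IsRationalExtension A B) {a : A} {b : B}
    (hb : b = algebraMap A B a) :
    MaxQuot.mk ⟨_, h.isDenseIdeal_denominators b⟩ (h.mulDenominators b) =
      algebraMap A (MaxQuot A) a :=
  h.mk_mulDenominators_eq fun d => by rw [hb, ← map_mul]; rfl

/-- The embedding over `A` of a rational extension `B` of `A` into the maximal ring of quotients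
of `A`: an element `b` acts by multiplication on its ideal of denominators. -/
noncomputable def toMaxQuot (h : IsRationalExtension A B) : B →ₐ[A] MaxQuot A where
  toFun b := MaxQuot.mk ⟨_, h.isDenseIdeal_denominators b⟩ (h.mulDenominators b)
  map_one' := (h.mk_mulDenominators_eq_algebraMap (map_one _).symm).trans (map_one _)
  map_mul' := h.mk_mulDenominators_mul
  map_zero' := (h.mk_mulDenominators_eq_algebraMap (map_zero _).symm).trans (map_zero _)
  map_add' := h.mk_mulDenominators_add
  commutes' _ := h.mk_mulDenominators_eq_algebraMap rfl

theorem toMaxQuot_eq_mk_iff (h : IsRationalExtension A B) {b : B} {D : DenseIdeals A}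
    {φ : HomIdeal D} :
    h.toMaxQuot b = MaxQuot.mk D φ ↔
      ∀ d : D.ideal, b * algebraMap A B d = algebraMap A B (φ d) := by
  refine ⟨fun hbφ d => ?_, h.mk_mulDenominators_eq⟩
  obtain ⟨F, hb, hD, hagree⟩ := MaxQuot.exists_agree_of_mk_eq hbφ
  refine h.eq_of_forall_mul_eq F.dense fun x hx => ?_
  rw [mul_right_comm, ← h.algebraMap_mulDenominators b ⟨x, hb hx⟩, hagree ⟨x, hx⟩, ← map_mul,
    ← map_mul, mul_comm, HomIdeal.mul_apply_comm φ d ⟨x, hD hx⟩, mul_comm x]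

theorem toMaxQuot_injective (h : IsRationalExtension A B) : Injective h.toMaxQuot :=
  fun _ c hbc => h.eq_of_forall_mul_eq (h.isDenseIdeal_denominators c) fun d hd =>
    (h.toMaxQuot_eq_mk_iff.1 hbc ⟨d, hd⟩).trans (h.algebraMap_mulDenominators c ⟨d, hd⟩)

theorem tower_top {C : Type*} [CommRing C] [Algebra A C] [Algebra B C] [IsScalarTower A B C]
    (h : IsRationalExtension A C) (hBC : Injective (algebraMap B C)) :
    IsRationalExtension B C := by
  refine ⟨hBC, fun c c' hc' => ?_⟩
  obtain ⟨a, ⟨x, hx⟩, ha⟩ := h.2 c c' hc'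
  refine ⟨algebraMap A B a, ⟨algebraMap A B x, ?_⟩, ?_⟩
  · rw [← IsScalarTower.algebraMap_apply, ← IsScalarTower.algebraMap_apply, hx]
  · rwa [← IsScalarTower.algebraMap_apply]

end IsRationalExtension

theorem IsRationallyComplete.toMaxQuot_surjective {A : Type u} {B : Type v} [CommRing A]
    [CommRing B] [Algebra A B] (hB : IsRationallyComplete.{v, u} B)
    (h : IsRationalExtension A B) : Surjective h.toMaxQuot := by
  let _ : Algebra B (MaxQuot A) := h.toMaxQuot.toRingHom.toAlgebra
  have : IsScalarTower A B (MaxQuot A) := .of_algebraMap_eq fun a => (h.toMaxQuot.commutes a).symm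
  exact hB (MaxQuot A) (isRationalExtension_maxQuot.tower_top h.toMaxQuot_injective)

/-- A rationally complete ring is the maximal ring of quotients of every subring of which it is a
rational extension. -/
noncomputable def IsRationallyComplete.maxQuotEquiv {A : Type u} {B : Type v} [CommRing A]
    [CommRing B] [Algebra A B] (hB : IsRationallyComplete.{v, u} B)
    (h : IsRationalExtension A B) : MaxQuot A ≃ₐ[A] B :=
  (AlgEquiv.ofBijective h.toMaxQuot ⟨h.toMaxQuot_injective, hB.toMaxQuot_surjective h⟩).symm

theorem isRationallyComplete_of_exists_mul {A : Type u} [CommRing A]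
    (hA : ∀ (D : DenseIdeals A) (φ : HomIdeal D), ∃ c, ∀ d : D.ideal, c * d = φ d) :
    IsRationallyComplete.{u, v} A := by
  intro B _ _ h b
  obtain ⟨c, hc⟩ := hA ⟨_, h.isDenseIdeal_denominators b⟩ (h.mulDenominators b)
  refine ⟨c, h.eq_of_forall_mul_eq (h.isDenseIdeal_denominators b) fun d hd => ?_⟩
  rw [← h.algebraMap_mulDenominators b ⟨d, hd⟩, ← hc ⟨d, hd⟩, map_mul]

end MaximalQuotients

section Topology

variable {X Y ι : Type*} [TopologicalSpace X]

theorem exists_pairwise_disjoint_isOpen_refinement {O : ι → Set X} (hO : ∀ i, IsOpen (O i))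
    (hdense : Dense (⋃ i, O i)) :
    ∃ W : ι → Set X, (∀ i, IsOpen (W i)) ∧ (∀ i, W i ⊆ O i) ∧ Pairwise (Disjoint on W) ∧
      Dense (⋃ i, W i) := by
  obtain ⟨_, _⟩ := exists_wellFoundedLT ι
  refine ⟨fun i => O i \ closure (⋃ j < i, O j), fun i => (hO i).sdiff isClosed_closure,
    fun i => sdiff_subset, (pairwise_disjoint_on _).2 fun j i hji => ?_, ?_⟩
  · have hj : O j ⊆ closure (⋃ j < i, O j) :=
      (subset_iUnion₂ (s := fun j (_ : j < i) => O j) j hji).trans subset_closure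
    exact disjoint_sdiff_right.mono_left (sdiff_subset.trans hj)
  refine dense_iff_inter_open.2 fun U hU hne => ?_
  have hmeets : {i | (U ∩ O i).Nonempty}.Nonempty := by
    obtain ⟨x, hxU, hx⟩ := hdense.inter_open_nonempty U hU hne
    obtain ⟨i, hi⟩ := mem_iUnion.1 hx
    exact ⟨i, x, hxU, hi⟩
  obtain ⟨i, ⟨x, hxU, hxO⟩, hmin⟩ := WellFounded.has_min wellFounded_lt _ hmeets
  have hdisj : Disjoint U (closure (⋃ j < i, O j)) := by
    refine Disjoint.closure_right ?_ hU
    simp only [disjoint_iUnion_right]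
    exact fun j hj => disjoint_iff_inter_eq_empty.2 <|
      not_nonempty_iff_eq_empty.1 fun hUj => hmin j hUj hj
  exact ⟨x, hxU, mem_iUnion.2 ⟨i, hxO, disjoint_left.1 hdisj hxU⟩⟩

theorem exists_continuousOn_glue [TopologicalSpace Y] [Nonempty Y] {W S : ι → Set X}
    {F : ι → X → Y} (hW : ∀ i, IsOpen (W i)) (hdisj : Pairwise (Disjoint on W))
    (hF : ∀ i, ContinuousOn (F i) (W i ∩ S i)) :
    ∃ G : X → Y, ContinuousOn G (⋃ i, W i ∩ S i) ∧ ∀ i, EqOn G (F i) (W i) := by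
  have hval (x : X) : ∃ y, ∀ i, x ∈ W i → y = F i x := by
    by_cases hx : ∃ i, x ∈ W i
    · obtain ⟨i, hi⟩ := hx
      refine ⟨F i x, fun j hj => ?_⟩
      rw [hdisj.eq (not_disjoint_iff.2 ⟨x, hi, hj⟩)]
    · exact ⟨Classical.arbitrary Y, fun i hi => (hx ⟨i, hi⟩).elim⟩
  choose G hG using hval
  refine ⟨G, fun x hx => ?_, fun i x hx => hG x i hx⟩
  obtain ⟨i, hxi⟩ := mem_iUnion.1 hx
  have hnear : (⋃ j, W j ∩ S j) ∩ W i ⊆ W i ∩ S i := by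
    rintro z ⟨hz, hzi⟩
    obtain ⟨j, hzj⟩ := mem_iUnion.1 hz
    rwa [hdisj.eq (not_disjoint_iff.2 ⟨z, hzi, hzj.1⟩)]
  have hGi : ContinuousOn G (W i ∩ S i) := (hF i).congr fun z hz => hG z i hz.1
  exact (continuousWithinAt_inter ((hW i).mem_nhds hxi.1)).1 ((hGi x hxi).mono hnear)

theorem exists_continuousOn_isOpen_dense_dist_le [PseudoMetricSpace Y] [Nonempty Y] {g : X → Y}
    {G : Set X} (hG : Dense G) (hg : ContinuousOn g G) {r : ℝ} (hr : 0 < r) :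
    ∃ (T : Set X) (k : X → Y), IsOpen T ∧ Dense T ∧ ContinuousOn k T ∧
      ∀ x ∈ G ∩ T, dist (g x) (k x) ≤ r := by
  have hlocal (p : G) :
      ∃ O : Set X, IsOpen O ∧ (p : X) ∈ O ∧ ∀ x ∈ O ∩ G, dist (g x) (g p) ≤ r := by
    obtain ⟨O, hO, hpO, hOr⟩ :=
      mem_nhdsWithin.1 ((hg p p.2).preimage_mem_nhdsWithin (Metric.closedBall_mem_nhds (g p) hr))
    exact ⟨O, hO, hpO, hOr⟩
  choose O hO hpO hOr using hlocal
  have hdense : Dense (⋃ p, O p) := hG.mono fun p hp => mem_iUnion.2 ⟨⟨p, hp⟩, hpO ⟨p, hp⟩⟩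
  obtain ⟨W, hW, hWO, hdisj, hWdense⟩ := exists_pairwise_disjoint_isOpen_refinement hO hdense
  obtain ⟨k, hk, hkW⟩ := exists_continuousOn_glue (S := fun _ => univ)
    (F := fun (p : G) _ => g p) hW hdisj fun _ => continuousOn_const
  simp only [inter_univ] at hk
  refine ⟨⋃ p, W p, k, isOpen_iUnion hW, hWdense, hk, ?_⟩
  rintro x ⟨hxG, hxT⟩
  obtain ⟨p, hp⟩ := mem_iUnion.1 hxT
  rw [hkW p hp]
  exact hOr p x ⟨hWO p hp, hxG⟩

theorem exists_isGδ_continuousOn_extension [TopologicalSpace Y] {i : X → Y}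
    (hi : IsDenseInducing i) {f : X → ℝ} (hf : Continuous f) :
    ∃ (G : Set Y) (g : Y → ℝ), IsGδ G ∧ range i ⊆ G ∧ ContinuousOn g G ∧ ∀ x, g (i x) = f x := by
  let g : Y → ℝ := fun y => limsup f (comap i (𝓝 y))
  have hgi (x : X) : g (i x) = f x := by
    change limsup f (comap i (𝓝 (i x))) = f x
    rw [← hi.nhds_eq_comap]
    exact hf.continuousAt.tendsto.limsup_eq
  refine ⟨{y | ContinuousAt g y}, g, IsGδ.setOfPred_continuousAt g, ?_,
    fun y hy => hy.continuousWithinAt, hgi⟩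
  rintro _ ⟨x, rfl⟩
  refine Metric.nhds_basis_closedBall.tendsto_right_iff.2 fun ε hε => ?_
  have hx : f ⁻¹' Metric.closedBall (f x) ε ∈ comap i (𝓝 (i x)) := by
    rw [← hi.nhds_eq_comap]
    exact hf.continuousAt (Metric.closedBall_mem_nhds (f x) hε)
  obtain ⟨V, hV, hVf⟩ := hx
  filter_upwards [eventually_mem_nhds_iff.2 hV] with y hy
  have := hi.comap_nhds_neBot y
  have hclose : ∀ᶠ z in comap i (𝓝 y), f z ∈ Icc (f x - ε) (f x + ε) := by
    rw [← Real.closedBall_eq_Icc]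
    exact mem_of_superset (preimage_mem_comap hy) hVf
  have hle : ∀ᶠ z in comap i (𝓝 y), f z ≤ f x + ε := hclose.mono fun _ h => h.2
  have hge : ∀ᶠ z in comap i (𝓝 y), f x - ε ≤ f z := hclose.mono fun _ h => h.1
  rw [hgi, Real.closedBall_eq_Icc]
  exact ⟨le_limsup_of_frequently_le hge.frequently (isBoundedUnder_of_eventually_le hle),
    limsup_le_of_le (isBoundedUnder_of_eventually_ge hge).isCoboundedUnder_le hle⟩

end Topology

namespace CLim

section Representatives

variable {X : Type*} [TopologicalSpace X] {𝒮 : DenseBase X}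

/-- `a ∈ C[𝒮]` is the class of the restriction to `S ∈ 𝒮` of `F`. Representatives are total
functions on `X`, so that those living on different members of `𝒮` can be compared directly. -/
def Represents (a : CLim 𝒮) (S : Set X) (F : X → ℝ) : Prop :=
  ∃ (hS : S ∈ 𝒮.sets) (hF : ContinuousOn F S),
    a = mk ⟨S, hS⟩ ⟨S.domRestrict F, hF.domRestrict⟩

theorem exists_represents_mk (S : 𝒮.Index) (f : C(S.set, ℝ)) :
    ∃ F : X → ℝ, (∀ x : S.set, F x = f x) ∧ Represents (mk S f) S.set F := by
  have hf : S.set.domRestrict (extend Subtype.val f 0) = f :=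
    funext (Subtype.val_injective.extend_apply f 0)
  refine ⟨extend Subtype.val f 0, congrFun hf, S.mem,
    continuousOn_iff_continuous_domRestrict.2 (by rw [hf]; exact f.continuous), ?_⟩
  congr 1
  exact DFunLike.coe_injective hf.symm

theorem exists_represents (a : CLim 𝒮) : ∃ S F, Represents a S F := by
  induction a using ind₁ with | _ S f
  obtain ⟨F, -, hF⟩ := exists_represents_mk S f
  exact ⟨_, F, hF⟩

theorem exists_represents_of_continuousOn {S : Set X} (hS : S ∈ 𝒮.sets) {F : X → ℝ}
    (hF : ContinuousOn F S) : ∃ a : CLim 𝒮, Represents a S F :=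
  ⟨_, hS, hF, rfl⟩

theorem represents_zero {S : Set X} (hS : S ∈ 𝒮.sets) : Represents (0 : CLim 𝒮) S 0 :=
  ⟨hS, continuousOn_const, (mk_zero _).symm⟩

theorem represents_ofC {S : Set X} (hS : S ∈ 𝒮.sets) (f : C(X, ℝ)) : Represents (ofC 𝒮 f) S f :=
  ⟨hS, f.continuous.continuousOn, ofC_eq ⟨S, hS⟩ f⟩

namespace Represents

variable {a b : CLim 𝒮} {S T : Set X} {F G : X → ℝ}

theorem mem (ha : Represents a S F) : S ∈ 𝒮.sets := ha.1

theorem continuousOn (ha : Represents a S F) : ContinuousOn F S := ha.2.1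

theorem mono (ha : Represents a S F) (hT : T ∈ 𝒮.sets) (hTS : T ⊆ S) : Represents a T F := by
  obtain ⟨hS, hF, rfl⟩ := ha
  exact ⟨hT, hF.mono hTS, (mk_res (S := ⟨S, hS⟩) (T := ⟨T, hT⟩) hTS _).symm⟩

theorem inter_left (ha : Represents a S F) (hT : T ∈ 𝒮.sets) : Represents a (S ∩ T) F :=
  ha.mono (𝒮.inter_mem _ ha.mem _ hT) inter_subset_left

theorem inter_right (ha : Represents a T F) (hS : S ∈ 𝒮.sets) : Represents a (S ∩ T) F :=
  ha.mono (𝒮.inter_mem _ hS _ ha.mem) inter_subset_right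

theorem add (ha : Represents a S F) (hb : Represents b T G) :
    Represents (a + b) (S ∩ T) (F + G) := by
  obtain ⟨hS, hF, rfl⟩ := ha.inter_left hb.mem
  obtain ⟨-, hG, rfl⟩ := hb.inter_right ha.mem
  exact ⟨hS, hF.add hG, (mk_add _ _ _).symm⟩

theorem mul (ha : Represents a S F) (hb : Represents b T G) :
    Represents (a * b) (S ∩ T) (F * G) := by
  obtain ⟨hS, hF, rfl⟩ := ha.inter_left hb.mem
  obtain ⟨-, hG, rfl⟩ := hb.inter_right ha.mem
  exact ⟨hS, hF.mul hG, (mk_mul _ _ _).symm⟩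

theorem dist_eq (ha : Represents a S F) (hb : Represents b T G) :
    dist a b = ⨆ x : ↥(S ∩ T), |F x - G x| / (1 + |F x - G x|) := by
  obtain ⟨hS, hF, rfl⟩ := ha.inter_left hb.mem
  obtain ⟨-, hG, rfl⟩ := hb.inter_right ha.mem
  change size _ = _
  rw [← mk_sub]
  rfl

theorem div_le_dist (ha : Represents a S F) (hb : Represents b T G) {x : X} (hx : x ∈ S ∩ T) :
    |F x - G x| / (1 + |F x - G x|) ≤ dist a b :=
  ha.dist_eq hb ▸ le_ciSup (bddAbove_size fun y : ↥(S ∩ T) => F y - G y) ⟨x, hx⟩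

theorem dist_le_of_forall_div_le (ha : Represents a S F) (hb : Represents b T G) {r : ℝ}
    (hr : 0 ≤ r) (h : ∀ x ∈ S ∩ T, |F x - G x| / (1 + |F x - G x|) ≤ r) : dist a b ≤ r :=
  ha.dist_eq hb ▸ Real.iSup_le (fun x => h x x.2) hr

theorem dist_le (ha : Represents a S F) (hb : Represents b T G) {r : ℝ} (hr : 0 ≤ r)
    (h : ∀ x ∈ S ∩ T, |F x - G x| ≤ r) : dist a b ≤ r :=
  ha.dist_le_of_forall_div_le hb hr fun x hx =>
    (div_le_self (abs_nonneg _) (le_add_of_nonneg_right (abs_nonneg _))).trans (h x hx)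

theorem abs_sub_lt_of_dist_lt (ha : Represents a S F) (hb : Represents b T G) {ε : ℝ} (hε : 0 < ε)
    (h : dist a b < ε / (1 + ε)) {x : X} (hx : x ∈ S ∩ T) : |F x - G x| < ε := by
  have hdiv := (ha.div_le_dist hb hx).trans_lt h
  rw [div_lt_div_iff₀ (by positivity) (by positivity)] at hdiv
  linarith

theorem eqOn (ha : Represents a S F) (ha' : Represents a T G) : EqOn F G (S ∩ T) := fun x hx =>
  eq_of_forall_dist_le fun ε hε =>
    (ha.abs_sub_lt_of_dist_lt ha' hε ((dist_self a).trans_lt (by positivity)) hx).le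

theorem eq_of_eqOn (ha : Represents a S F) (hb : Represents b T G) (hFG : EqOn F G (S ∩ T)) :
    a = b :=
  dist_le_zero.1 <| ha.dist_le hb le_rfl fun x hx => by rw [hFG hx, sub_self, abs_zero]

theorem exists_isOpen_cozero (ha : Represents a S F) :
    ∃ O, IsOpen O ∧ ∀ x ∈ S, x ∈ O ↔ F x ≠ 0 := by
  obtain ⟨O, hO, hOS⟩ := continuousOn_iff'.1 ha.continuousOn {0}ᶜ isOpen_compl_singleton
  exact ⟨O, hO, fun x hx => by simpa [hx] using (congrArg (x ∈ ·) hOS).symm⟩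

end Represents

theorem mem_bounded_iff {a : CLim 𝒮} :
    a ∈ bounded 𝒮 ↔ ∃ M S F, Represents a S F ∧ ∀ x ∈ S, |F x| ≤ M := by
  constructor
  · rintro ⟨M, S, f, rfl, hM⟩
    obtain ⟨F, hF, hr⟩ := exists_represents_mk S f
    exact ⟨M, _, F, hr, fun x hx => hF ⟨x, hx⟩ ▸ hM _⟩
  · rintro ⟨M, S, F, ⟨hS, hF, rfl⟩, hM⟩
    exact ⟨M, _, _, rfl, fun x => hM x x.2⟩

theorem absLE_iff {M : ℝ} {a b : CLim 𝒮} :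
    AbsLE M a b ↔ ∃ S F G, Represents a S F ∧ Represents b S G ∧ ∀ x ∈ S, |F x| ≤ M * |G x| := by
  constructor
  · rintro ⟨S, f, g, rfl, rfl, h⟩
    obtain ⟨F, hF, hf⟩ := exists_represents_mk S f
    obtain ⟨G, hG, hg⟩ := exists_represents_mk S g
    exact ⟨_, F, G, hf, hg, fun x hx => hF ⟨x, hx⟩ ▸ hG ⟨x, hx⟩ ▸ h _⟩
  · rintro ⟨S, F, G, ⟨hS, hF, rfl⟩, ⟨-, hG, rfl⟩, h⟩
    exact ⟨_, _, _, rfl, rfl, fun x => h x x.2⟩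

theorem ofC_injective : Injective (ofC 𝒮) := fun f g h => by
  obtain ⟨S, hS⟩ := 𝒮.nonempty
  have hfg := (represents_ofC hS f).eqOn (h ▸ represents_ofC hS g)
  rw [inter_self] at hfg
  exact DFunLike.coe_injective (f.continuous.ext_on (𝒮.dense S hS) g.continuous hfg)

end Representatives

end CLim

section Glueing

theorem dense_iUnion_inter {X ι : Type*} [TopologicalSpace X] {W S : ι → Set X}
    (hW : ∀ i, IsOpen (W i)) (hdense : Dense (⋃ i, W i)) (hS : ∀ i, Dense (S i)) :
    Dense (⋃ i, W i ∩ S i) := by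
  refine dense_iff_inter_open.2 fun U hU hne => ?_
  obtain ⟨x, hxU, hx⟩ := hdense.inter_open_nonempty U hU hne
  obtain ⟨i, hxi⟩ := mem_iUnion.1 hx
  obtain ⟨y, ⟨hyU, hyW⟩, hyS⟩ := (hS i).inter_open_nonempty _ (hU.inter (hW i)) ⟨x, hxU, hxi⟩
  exact ⟨y, hyU, mem_iUnion.2 ⟨i, hyW, hyS⟩⟩

theorem isGδ_iUnion_inter {X ι : Type*} [TopologicalSpace X] {W S : ι → Set X}
    (hW : ∀ i, IsOpen (W i)) (hdisj : Pairwise (Disjoint on W)) (hS : ∀ i, IsGδ (S i)) :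
    IsGδ (⋃ i, W i ∩ S i) := by
  choose O hO hSO using fun i => isGδ_iff_eq_iInter_nat.1 (hS i)
  have hswap : ⋃ i, W i ∩ S i = ⋂ n, ⋃ i, W i ∩ O i n := by
    ext x
    simp only [hSO, mem_iUnion, mem_inter_iff, mem_iInter]
    refine ⟨fun ⟨i, hi, hn⟩ n => ⟨i, hi, hn n⟩, fun h => ?_⟩
    choose i hi hn using h
    exact ⟨i 0, hi 0, fun n => hdisj.eq (not_disjoint_iff.2 ⟨x, hi n, hi 0⟩) ▸ hn n⟩
  rw [hswap]
  exact .iInter_of_isOpen fun n => isOpen_iUnion fun i => (hW i).inter (hO i n)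

namespace DenseBase

variable {X : Type u} [TopologicalSpace X] {𝒮 : DenseBase X}

/-- A base of dense sets is glueable if members `S i`, chosen one for each piece `W i` of a disjoint
family of open sets with dense union, fit together to a member of the base. Families indexed by
types in the universe of `X` are enough, as the nonempty pieces are indexed by points of `X`. -/
def IsGlueable (𝒮 : DenseBase X) : Prop :=
  ∀ ⦃ι : Type u⦄ (W S : ι → Set X), (∀ i, IsOpen (W i)) → Pairwise (Disjoint on W) →
    Dense (⋃ i, W i) → (∀ i, S i ∈ 𝒮.sets) → ⋃ i, W i ∩ S i ∈ 𝒮.sets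

theorem isGlueable_denseOpens : IsGlueable (denseOpens X) := fun _ _ _ hW _ hdense hS =>
  ⟨isOpen_iUnion fun i => (hW i).inter (hS i).1, dense_iUnion_inter hW hdense fun i => (hS i).2⟩

theorem isGlueable_denseGδ [BaireSpace X] : IsGlueable (denseGδ X) :=
  fun _ _ _ hW hdisj hdense hS =>
  ⟨isGδ_iUnion_inter hW hdisj fun i => (hS i).1, dense_iUnion_inter hW hdense fun i => (hS i).2⟩

theorem IsGlueable.inter_mem (h𝒮 : 𝒮.IsGlueable) {W S : Set X} (hW : IsOpen W) (hdense : Dense W)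
    (hS : S ∈ 𝒮.sets) : W ∩ S ∈ 𝒮.sets := by
  have hglue := h𝒮 (ι := PUnit) (fun _ => W) (fun _ => S) (fun _ => hW)
    Subsingleton.pairwise (by rwa [iUnion_const]) fun _ => hS
  rwa [iUnion_const] at hglue

end DenseBase

end Glueing

namespace CLim

section RationalCompleteness

variable {X : Type u} [TopologicalSpace X] {𝒮 : DenseBase X} {ι : Type u}

theorem exists_represents_indicator (h𝒮 : 𝒮.IsGlueable) {V : Set X} (hV : IsOpen V) :
    ∃ (a : CLim 𝒮) (S : Set X), Represents a S (V.indicator 1) := by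
  obtain ⟨S, hS⟩ := 𝒮.nonempty
  have hdense : Dense (frontier V)ᶜ := by
    rw [← interior_eq_empty_iff_dense_compl, ← frontier_compl, interior_frontier hV.isClosed_compl]
  have hcont : ContinuousOn (V.indicator (1 : X → ℝ)) ((frontier V)ᶜ ∩ S) := fun x hx =>
    (continuousOn_const.continuousAt_indicator hx.1).continuousWithinAt
  exact ⟨_, _, h𝒮.inter_mem isClosed_frontier.isOpen_compl hdense hS, hcont, rfl⟩

theorem dense_iUnion_cozero (h𝒮 : 𝒮.IsGlueable) {d : ι → CLim 𝒮} {S O : ι → Set X}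
    {D : ι → X → ℝ} (hd : ∀ i, Represents (d i) (S i) (D i))
    (hO : ∀ i, ∀ x ∈ S i, x ∈ O i ↔ D i x ≠ 0) (hann : ∀ a, (∀ i, a * d i = 0) → a = 0) :
    Dense (⋃ i, O i) := by
  set V : Set X := (closure (⋃ i, O i))ᶜ
  have hV : IsOpen V := isClosed_closure.isOpen_compl
  obtain ⟨a, T, ha⟩ := exists_represents_indicator h𝒮 hV
  have ha₀ : a = 0 := hann a fun i => by
    refine (ha.mul (hd i)).eq_of_eqOn (represents_zero (hd i).mem) fun x hx => ?_
    by_cases hxV : x ∈ V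
    · have hxO : x ∉ O i := fun hxO => hxV (subset_closure (mem_iUnion.2 ⟨i, hxO⟩))
      have hDx : D i x = 0 := not_not.1 (mt (hO i x hx.2).2 hxO)
      simp [hDx]
    · simp [hxV]
  have hVempty : V = ∅ := by
    by_contra hne
    obtain ⟨x, hxV, hxT⟩ :=
      (𝒮.dense T ha.mem).inter_open_nonempty V hV (nonempty_iff_ne_empty.2 hne)
    have hindicator : V.indicator 1 x = (0 : ℝ) :=
      (ha₀ ▸ ha : Represents 0 T _).eqOn (represents_zero ha.mem) ⟨hxT, hxT⟩
    exact one_ne_zero ((indicator_of_mem hxV 1).symm.trans hindicator)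
  exact dense_iff_closure_eq.2 (compl_empty_iff.1 hVempty)

theorem exists_mul_eq (h𝒮 : 𝒮.IsGlueable) {d p : ι → CLim 𝒮}
    (hann : ∀ a, (∀ i, a * d i = 0) → a = 0) (hcompat : ∀ i j, d i * p j = d j * p i) :
    ∃ c, ∀ i, c * d i = p i := by
  choose S D hD using fun i => exists_represents (d i)
  choose T P hP using fun i => exists_represents (p i)
  choose O hO hcozero using fun i => (hD i).exists_isOpen_cozero
  obtain ⟨W, hW, hWO, hdisj, hdense⟩ := exists_pairwise_disjoint_isOpen_refinement hO
    (dense_iUnion_cozero h𝒮 hD hcozero hann)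
  have hne (i : ι) {x : X} (hxW : x ∈ W i) (hxS : x ∈ S i) : D i x ≠ 0 :=
    (hcozero i x hxS).1 (hWO i hxW)
  have hquot (i : ι) : ContinuousOn (fun x => P i x / D i x) (W i ∩ (S i ∩ T i)) :=
    ((hP i).continuousOn.mono fun _ hx => hx.2.2).div
      ((hD i).continuousOn.mono fun _ hx => hx.2.1) fun _ hx => hne i hx.1 hx.2.1
  obtain ⟨G, hG, hGW⟩ := exists_continuousOn_glue hW hdisj hquot
  obtain ⟨c, hc⟩ := exists_represents_of_continuousOn
    (h𝒮 W _ hW hdisj hdense fun i => 𝒮.inter_mem _ (hD i).mem _ (hP i).mem) hG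
  refine ⟨c, fun j => (hc.mul (hD j)).eq_of_eqOn (hP j) ?_⟩
  rintro x ⟨⟨hxG, hxSj⟩, hxTj⟩
  obtain ⟨i, hxW, hxS, hxT⟩ := mem_iUnion.1 hxG
  have hdp : Represents (d j * p i) (S i ∩ T j) (D i * P j) := hcompat i j ▸ (hD i).mul (hP j)
  have hDP : D i x * P j x = D j x * P i x :=
    hdp.eqOn ((hD j).mul (hP i)) ⟨⟨hxS, hxTj⟩, hxSj, hxT⟩
  rw [Pi.mul_apply, hGW i hxW, div_mul_eq_mul_div, div_eq_iff (hne i hxW hxS), mul_comm (P j x),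
    hDP, mul_comm]

theorem isRationallyComplete (h𝒮 : 𝒮.IsGlueable) : IsRationallyComplete.{u, v} (CLim 𝒮) :=
  isRationallyComplete_of_exists_mul fun D φ =>
    exists_mul_eq h𝒮 (d := fun d : D.ideal => (d : CLim 𝒮))
      (fun a ha => D.dense a fun d hd => ha ⟨d, hd⟩) φ.mul_apply_comm

end RationalCompleteness

end CLim

theorem exists_continuousMap_tsupport_subset {X : Type*} [TopologicalSpace X]
    [CompletelyRegularSpace X] {V : Set X} (hV : IsOpen V) {x : X} (hx : x ∈ V) :
    ∃ f : C(X, ℝ), tsupport f ⊆ V ∧ f x ≠ 0 := by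
  obtain ⟨g, hg, hgx, hgV⟩ := CompletelyRegularSpace.completely_regular_isOpen x V hV hx
  refine ⟨⟨fun y => max (1 / 2 - g y) 0, by fun_prop⟩, ?_, by simp [hgx]⟩
  have hclosed : IsClosed {y | (g y : ℝ) ≤ 1 / 2} := isClosed_le (by fun_prop) continuous_const
  refine (closure_minimal (fun y hy => ?_) hclosed).trans fun y hy => ?_
  · by_contra hlt
    exact hy (max_eq_right (sub_nonpos.2 (not_le.1 hlt).le))
  · by_contra hyV
    have hy1 : (1 : ℝ) ≤ 1 / 2 := by simpa [hgV hyV] using hy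
    norm_num at hy1

namespace CLim

theorem isRationalExtension_Q {X : Type*} [TopologicalSpace X] [CompletelyRegularSpace X] :
    IsRationalExtension C(X, ℝ) (Q X) := by
  refine ⟨ofC_injective, fun b b' hb' => ?_⟩
  obtain ⟨V, F, hF⟩ := exists_represents b
  obtain ⟨V', F', hF'⟩ := exists_represents b'
  obtain ⟨x, ⟨hxV, hxV'⟩, hF'x⟩ : ∃ x ∈ V ∩ V', F' x ≠ 0 := by
    by_contra! hzero
    exact hb' ((hF'.inter_right hF.mem).eq_of_eqOn (represents_zero hF.mem)
      fun x hx => hzero x hx.1)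
  obtain ⟨f, hfV, hfx⟩ := exists_continuousMap_tsupport_subset hF.mem.1 hxV
  have hcont : Continuous (F * ⇑f) :=
    (hF.continuousOn.mul f.continuous.continuousOn).continuous_of_tsupport_subset hF.mem.1
      ((tsupport_mul_subset_right (f := F)).trans hfV)
  refine ⟨f, ⟨⟨F * ⇑f, hcont⟩, ?_⟩, fun hzero => mul_ne_zero hF'x hfx ?_⟩
  · exact (represents_ofC hF.mem _).eq_of_eqOn (hF.mul (represents_ofC hF.mem f)) fun _ _ => rfl
  · have hb'f : Represents (b' * ofC _ f) (V' ∩ V) (F' * ⇑f) := hF'.mul (represents_ofC hF.mem f)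
    exact hb'f.eqOn (hzero ▸ represents_zero hF.mem) ⟨⟨hxV', hxV⟩, hxV⟩

section Bounded

variable {X : Type u} [TopologicalSpace X] {𝒮 : DenseBase X}

theorem isRationalExtension_bounded : IsRationalExtension (bounded 𝒮) (CLim 𝒮) := by
  refine ⟨Subtype.val_injective, fun b b' hb' => ?_⟩
  obtain ⟨S, F, hF⟩ := exists_represents b
  obtain ⟨T, F', hF'⟩ := exists_represents b'
  have hpos (x : X) : 0 < 1 + F x ^ 2 := by positivity
  obtain ⟨a, ha⟩ := exists_represents_of_continuousOn hF.mem
    (F := fun x => 1 / (1 + F x ^ 2))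
    (continuousOn_const.div (continuousOn_const.add (hF.continuousOn.pow 2))
      fun x _ => (hpos x).ne')
  have ha_mem : a ∈ bounded 𝒮 := mem_bounded_iff.2 ⟨1, S, _, ha, fun x _ => by
    rw [abs_of_pos (one_div_pos.2 (hpos x)), div_le_one (hpos x)]
    nlinarith [sq_nonneg (F x)]⟩
  have hba_mem : b * a ∈ bounded 𝒮 := mem_bounded_iff.2 ⟨1, _, _, hF.mul ha, fun x _ => by
    rw [Pi.mul_apply, mul_one_div, abs_div, abs_of_pos (hpos x), div_le_one (hpos x)]
    nlinarith [sq_abs (F x), sq_nonneg (|F x| - 1 / 2)]⟩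
  refine ⟨⟨a, ha_mem⟩, ⟨⟨b * a, hba_mem⟩, rfl⟩, fun hzero => hb' ?_⟩
  have hb'a : Represents (0 : CLim 𝒮) (T ∩ S) (F' * fun x => 1 / (1 + F x ^ 2)) :=
    hzero ▸ hF'.mul ha
  refine (hF'.inter_left hF.mem).eq_of_eqOn (represents_zero hF.mem) fun x hx => ?_
  exact (mul_eq_zero.1 (hb'a.eqOn (represents_zero hF.mem) hx)).resolve_right
    (one_div_ne_zero (hpos x).ne')

theorem mem_bounded_of_forall_absLE {D : Ideal (bounded 𝒮)} (hD : IsDenseIdeal D) {c : CLim 𝒮}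
    {M : ℝ} (hc : ∀ d ∈ D, AbsLE M (c * d.1) d.1) : c ∈ bounded 𝒮 := by
  obtain ⟨S, F, hF⟩ := exists_represents c
  obtain ⟨a, ha⟩ := exists_represents_of_continuousOn hF.mem (F := fun x => max (|F x| - M) 0)
    ((hF.continuousOn.abs.sub continuousOn_const).sup continuousOn_const)
  have ha₀ : a = 0 := isRationalExtension_bounded.eq_zero_of_forall_mul_eq_zero hD fun d hd => by
    obtain ⟨T, P, G, hP, hG, hle⟩ := absLE_iff.1 (hc d hd)
    refine (ha.mul hG).eq_of_eqOn (represents_zero hF.mem) fun x hx => ?_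
    have hFG : F x * G x = P x := (hF.mul hG).eqOn hP ⟨hx.1, hx.1.2⟩
    have hle' : |F x| * |G x| ≤ M * |G x| := abs_mul (F x) (G x) ▸ hFG ▸ hle x hx.1.2
    rcases eq_or_ne (G x) 0 with hGx | hGx
    · exact mul_eq_zero_of_right _ hGx
    · refine mul_eq_zero_of_left (max_eq_right (sub_nonpos.2 ?_)) _
      exact le_of_mul_le_mul_right hle' (abs_pos.2 hGx)
  refine mem_bounded_iff.2 ⟨M, S, F, hF, fun x hx => sub_nonpos.1 (max_eq_right_iff.1 ?_)⟩
  exact ha.eqOn (ha₀ ▸ represents_zero ha.mem) ⟨hx, hx⟩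

theorem exists_forall_absLE_of_mem_bounded {c : CLim 𝒮} (hc : c ∈ bounded 𝒮) :
    ∃ M, ∀ d, AbsLE M (c * d) d := by
  obtain ⟨M, S, F, hF, hM⟩ := mem_bounded_iff.1 hc
  refine ⟨M, fun d => absLE_iff.2 ?_⟩
  obtain ⟨T, G, hG⟩ := exists_represents d
  refine ⟨_, _, _, hF.mul hG, hG.inter_right hF.mem, fun x hx => ?_⟩
  rw [Pi.mul_apply, abs_mul]
  gcongr
  exact hM x hx.1

theorem isBoundedQuotient_iff_mem_range (h𝒮 : 𝒮.IsGlueable) (q : MaxQuot (bounded 𝒮)) :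
    IsBoundedQuotient q ↔ q ∈ range (algebraMap (bounded 𝒮) (MaxQuot (bounded 𝒮))) := by
  constructor
  · rintro ⟨D, φ, M, rfl, hM⟩
    obtain ⟨c, hc⟩ := (isRationallyComplete h𝒮).toMaxQuot_surjective isRationalExtension_bounded
      (MaxQuot.mk D φ)
    have hmul := isRationalExtension_bounded.toMaxQuot_eq_mk_iff.1 hc
    have hc_mem : c ∈ bounded 𝒮 := mem_bounded_of_forall_absLE D.dense fun d hd => by
      have hcd : c * d = φ ⟨d, hd⟩ := hmul ⟨d, hd⟩
      exact hcd ▸ hM ⟨d, hd⟩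
    rw [← hc]
    exact ⟨⟨c, hc_mem⟩, (isRationalExtension_bounded.toMaxQuot.commutes _).symm⟩
  · rintro ⟨a, rfl⟩
    obtain ⟨M, hM⟩ := exists_forall_absLE_of_mem_bounded a.2
    exact ⟨_, MaxQuot.mulHom _ a, M, rfl, fun d => hM d⟩

end Bounded

end CLim

namespace CLim

section Completion

theorem completeSpace_of_iInter_mem {X : Type*} [TopologicalSpace X] {𝒮 : DenseBase X}
    (hInter : ∀ S : ℕ → Set X, (∀ n, S n ∈ 𝒮.sets) → ⋂ n, S n ∈ 𝒮.sets) :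
    CompleteSpace (CLim 𝒮) := by
  refine Metric.complete_of_cauchySeq_tendsto fun u hu => ?_
  choose S F hF using fun n => exists_represents (u n)
  have hT := hInter S fun n => (hF n).mem
  set T := ⋂ n, S n
  replace hF (n : ℕ) : Represents (u n) T (F n) := (hF n).mono hT (iInter_subset S n)
  have hcauchy : UniformCauchySeqOn F atTop T := by
    refine Metric.uniformCauchySeqOn_iff.2 fun ε hε => ?_
    obtain ⟨N, hN⟩ := Metric.cauchySeq_iff.1 hu (ε / (1 + ε)) (by positivity)
    exact ⟨N, fun m hm n hn x hx =>
      (hF m).abs_sub_lt_of_dist_lt (hF n) hε (hN m hm n hn) ⟨hx, hx⟩⟩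
  have hlim (x : X) (hx : x ∈ T) : ∃ l, Tendsto (F · x) atTop (𝓝 l) :=
    cauchySeq_tendsto_of_complete (hcauchy.cauchySeq hx)
  choose! L hL using hlim
  have hunif : TendstoUniformlyOn F L atTop T := hcauchy.tendstoUniformlyOn_of_tendsto hL
  obtain ⟨c, hc⟩ := exists_represents_of_continuousOn hT
    (hunif.continuousOn (.of_forall fun n => (hF n).continuousOn))
  refine ⟨c, tendsto_iff_dist_tendsto_zero.2 ?_⟩
  refine Metric.tendsto_atTop.2 fun ε hε => ?_
  obtain ⟨N, hN⟩ := eventually_atTop.1 (Metric.tendstoUniformlyOn_iff.1 hunif _ (half_pos hε))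
  refine ⟨N, fun n hn => ?_⟩
  have hdist : dist (u n) c ≤ ε / 2 := (hF n).dist_le hc (half_pos hε).le fun x hx =>
    abs_sub_comm (F n x) (L x) ▸ (hN n hn x hx.1).le
  rw [Real.dist_0_eq_abs, abs_of_nonneg dist_nonneg]
  exact hdist.trans_lt (half_lt_self hε)

theorem completeSpace_denseGδ (X : Type*) [TopologicalSpace X] [BaireSpace X] :
    CompleteSpace (CLim (denseGδ X)) :=
  completeSpace_of_iInter_mem fun _ hS =>
    ⟨.iInter fun n => (hS n).1, dense_iInter_of_Gδ (fun n => (hS n).1) fun n => (hS n).2⟩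

variable {X K : Type*} [TopologicalSpace X] [TopologicalSpace K] [BaireSpace K] {e : X → K}

/-- `b ∈ C[𝒢₀(K)]` extends `a ∈ Q(X)` along `e : X → K`: suitable representatives of `a` and
`b ∘ e` agree. -/
def IsExtension (e : X → K) (a : Q X) (b : CLim (denseGδ K)) : Prop :=
  ∃ V f G g, Represents a V f ∧ Represents b G g ∧ ∀ x ∈ V, e x ∈ G ∧ g (e x) = f x

namespace IsExtension

variable {a a' : Q X} {b b' : CLim (denseGδ K)}

theorem add (h : IsExtension e a b) (h' : IsExtension e a' b') :
    IsExtension e (a + a') (b + b') := by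
  obtain ⟨V, f, G, g, hf, hg, hfg⟩ := h
  obtain ⟨V', f', G', g', hf', hg', hfg'⟩ := h'
  exact ⟨_, _, _, _, hf.add hf', hg.add hg', fun x hx => ⟨⟨(hfg x hx.1).1, (hfg' x hx.2).1⟩,
    congrArg₂ (· + ·) (hfg x hx.1).2 (hfg' x hx.2).2⟩⟩

theorem mul (h : IsExtension e a b) (h' : IsExtension e a' b') :
    IsExtension e (a * a') (b * b') := by
  obtain ⟨V, f, G, g, hf, hg, hfg⟩ := h
  obtain ⟨V', f', G', g', hf', hg', hfg'⟩ := h'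
  exact ⟨_, _, _, _, hf.mul hf', hg.mul hg', fun x hx => ⟨⟨(hfg x hx.1).1, (hfg' x hx.2).1⟩,
    congrArg₂ (· * ·) (hfg x hx.1).2 (hfg' x hx.2).2⟩⟩

theorem dist_eq (he : IsDenseInducing e) (h : IsExtension e a b) (h' : IsExtension e a' b') :
    dist a a' = dist b b' := by
  obtain ⟨V, f, G, g, hf, hg, hfg⟩ := h
  obtain ⟨V', f', G', g', hf', hg', hfg'⟩ := h'
  have hmaps : MapsTo e (V ∩ V') (G ∩ G') := fun x hx => ⟨(hfg x hx.1).1, (hfg' x hx.2).1⟩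
  refine le_antisymm (hf.dist_le_of_forall_div_le hf' dist_nonneg fun x hx => ?_)
    (hg.dist_le_of_forall_div_le hg' dist_nonneg fun y hy => ?_)
  · rw [← (hfg x hx.1).2, ← (hfg' x hx.2).2]
    exact hg.div_le_dist hg' (hmaps hx)
  · have hdense : Dense (e '' (V ∩ V')) :=
      he.dense.dense_image he.continuous ((denseOpens X).inter_mem _ hf.mem _ hf'.mem).2
    have hcont : ContinuousOn (fun y => |g y - g' y| / (1 + |g y - g' y|)) (G ∩ G') := by
      have hsub : ContinuousOn (fun y => |g y - g' y|) (G ∩ G') :=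
        ((hg.continuousOn.mono inter_subset_left).sub
          (hg'.continuousOn.mono inter_subset_right)).abs
      exact hsub.div (continuousOn_const.add hsub) fun y _ => by positivity
    have : (𝓝[e '' (V ∩ V')] y).NeBot := mem_closure_iff_nhdsWithin_neBot.1 (hdense y)
    refine le_of_tendsto ((hcont y hy).mono hmaps.image_subset) (eventually_mem_nhdsWithin.mono ?_)
    rintro _ ⟨x, hx, rfl⟩
    rw [(hfg x hx.1).2, (hfg' x hx.2).2]
    exact hf.div_le_dist hf' hx

theorem unique (he : IsDenseInducing e) (h : IsExtension e a b) (h' : IsExtension e a b') :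
    b = b' :=
  dist_eq_zero.1 <| (h.dist_eq he h').symm.trans (dist_self a)

end IsExtension

theorem isExtension_ofC (he : Continuous e) (f : C(K, ℝ)) :
    IsExtension e (ofC _ (f.comp ⟨e, he⟩)) (ofC _ f) :=
  ⟨univ, _, univ, _, represents_ofC (𝒮 := denseOpens X) ⟨isOpen_univ, dense_univ⟩ _,
    represents_ofC (𝒮 := denseGδ K) ⟨.univ, dense_univ⟩ _, fun _ _ => ⟨trivial, rfl⟩⟩

theorem exists_isExtension (he : IsDenseInducing e) (a : Q X) :
    ∃ b : CLim (denseGδ K), IsExtension e a b := by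
  obtain ⟨V, f, hf⟩ := exists_represents a
  have heV : IsDenseInducing fun x : V => e x :=
    ⟨he.isInducing.comp .subtypeVal,
      he.dense.comp (hf.mem.2.denseRange_val) he.continuous⟩
  obtain ⟨G, g, hG, hVG, hg, hgf⟩ :=
    exists_isGδ_continuousOn_extension heV hf.continuousOn.domRestrict
  obtain ⟨b, hb⟩ := exists_represents_of_continuousOn (𝒮 := denseGδ K)
    ⟨hG, heV.dense.mono hVG⟩ hg
  exact ⟨b, V, f, G, g, hf, hb, fun x hx => ⟨hVG ⟨⟨x, hx⟩, rfl⟩, hgf ⟨x, hx⟩⟩⟩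

theorem exists_isExtension_dist_le (he : IsDenseInducing e) (b : CLim (denseGδ K)) {r : ℝ}
    (hr : 0 < r) : ∃ (a : Q X) (b' : CLim (denseGδ K)), IsExtension e a b' ∧ dist b b' ≤ r := by
  obtain ⟨G, g, hg⟩ := exists_represents b
  obtain ⟨T, k, hT, hT_dense, hk, hgk⟩ :=
    exists_continuousOn_isOpen_dense_dist_le hg.mem.2 hg.continuousOn hr
  have hT_preimage : Dense (e ⁻¹' T) := he.dense_image.1 <| dense_closure.1 <|
    hT_dense.mono (he.dense.subset_closure_image_preimage_of_isOpen hT)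
  obtain ⟨a, ha⟩ := exists_represents_of_continuousOn (𝒮 := denseOpens X)
    ⟨hT.preimage he.continuous, hT_preimage⟩
    (hk.comp he.continuous.continuousOn (mapsTo_preimage e T))
  obtain ⟨b', hb'⟩ := exists_represents_of_continuousOn (𝒮 := denseGδ K) ⟨hT.isGδ, hT_dense⟩ hk
  exact ⟨a, b', ⟨_, _, _, _, ha, hb', fun x hx => ⟨hx, rfl⟩⟩, hg.dist_le hb' hr.le hgk⟩

/-- The embedding of `Q(X)` into `C[𝒢₀(K)]` for `X` densely embedded in `K`, which extends the
functions on dense open subsets of `X` to `G_δ`-sets of `K`. -/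
noncomputable def extensionHom (he : IsDenseInducing e) : Q X →+* CLim (denseGδ K) where
  toFun a := (exists_isExtension he a).choose
  map_one' := (exists_isExtension he 1).choose_spec.unique he <| by
    simpa only [ContinuousMap.one_comp, map_one] using isExtension_ofC he.continuous 1
  map_mul' a a' := (exists_isExtension he _).choose_spec.unique he <|
    (exists_isExtension he a).choose_spec.mul (exists_isExtension he a').choose_spec
  map_zero' := (exists_isExtension he 0).choose_spec.unique he <| by
    simpa only [ContinuousMap.zero_comp, map_zero] using isExtension_ofC he.continuous 0
  map_add' a a' := (exists_isExtension he _).choose_spec.unique he <|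
    (exists_isExtension he a).choose_spec.add (exists_isExtension he a').choose_spec

theorem isExtension_extensionHom (he : IsDenseInducing e) (a : Q X) :
    IsExtension e a (extensionHom (K := K) he a) :=
  (exists_isExtension he a).choose_spec

theorem isometry_extensionHom (he : IsDenseInducing e) : Isometry (extensionHom (K := K) he) :=
  .of_dist_eq fun a a' =>
    ((isExtension_extensionHom he a).dist_eq he (isExtension_extensionHom he a')).symm

theorem denseRange_extensionHom (he : IsDenseInducing e) :
    DenseRange (extensionHom (K := K) he) := by
  refine Metric.denseRange_iff.2 fun b r hr => ?_
  obtain ⟨a, b', hab', hdist⟩ := exists_isExtension_dist_le he b (half_pos hr)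
  refine ⟨a, ?_⟩
  rw [(isExtension_extensionHom he a).unique he hab']
  exact hdist.trans_lt (half_lt_self hr)

theorem extensionHom_ofC (he : IsDenseInducing e) (f : C(K, ℝ)) :
    extensionHom he (ofC _ (f.comp ⟨e, he.continuous⟩)) = ofC (denseGδ K) f :=
  (isExtension_extensionHom he _).unique he (isExtension_ofC he.continuous f)

end Completion

end CLim

end FGL

open FGL in
theorem mainTheorem4_general {X : Type u} [TopologicalSpace X] [CompletelyRegularSpace X]
    {K : Type*} [TopologicalSpace K] [BaireSpace K] {e : X → K} (he : IsDenseInducing e) :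
    Nonempty (MaxQuot C(X, ℝ) ≃ₐ[C(X, ℝ)] Q X) ∧
    (CompleteSpace (CLim (denseGδ K)) ∧
      ∃ ι : Q X →+* CLim (denseGδ K), Isometry ι ∧ DenseRange ι ∧
        ∀ f : C(K, ℝ),
          ι (algebraMap C(X, ℝ) (Q X) (f.comp ⟨e, he.continuous⟩)) =
            algebraMap C(K, ℝ) (CLim (denseGδ K)) f) ∧
    IsRationallyComplete.{_, v} (CLim (denseGδ K)) ∧
    Nonempty (MaxQuot (CLim.bounded (denseGδ K)) ≃ₐ[CLim.bounded (denseGδ K)] CLim (denseGδ K)) ∧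
    (∀ q : MaxQuot (CLim.bounded (denseGδ K)), IsBoundedQuotient q ↔
      q ∈ Set.range (algebraMap (CLim.bounded (denseGδ K))
        (MaxQuot (CLim.bounded (denseGδ K))))) := by
  have hX : (denseOpens X).IsGlueable := DenseBase.isGlueable_denseOpens
  have hK : (denseGδ K).IsGlueable := DenseBase.isGlueable_denseGδ
  refine ⟨⟨(CLim.isRationallyComplete hX).maxQuotEquiv CLim.isRationalExtension_Q⟩,
    ⟨CLim.completeSpace_denseGδ K, CLim.extensionHom he, ?_, ?_, ?_⟩,
    CLim.isRationallyComplete hK,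
    ⟨(CLim.isRationallyComplete hK).maxQuotEquiv CLim.isRationalExtension_bounded⟩,
    CLim.isBoundedQuotient_iff_mem_range hK⟩
  · exact CLim.isometry_extensionHom he
  · exact CLim.denseRange_extensionHom he
  · exact CLim.extensionHom_ofC he

theorem mainTheorem4 (X : Type u) [TopologicalSpace X] [T35Space X] :
    -- `Q(X)` is the maximal ring of quotients of `C(X)`
    Nonempty (FGL.MaxQuot C(X, ℝ) ≃ₐ[C(X, ℝ)] FGL.Q X) ∧
    -- `QBar X` is the metric completion of `Q(X)`, by an embedding of rings over `C(βX) = C*(X)`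
    (CompleteSpace (FGL.QBar X) ∧
      ∃ ι : FGL.Q X →+* FGL.QBar X, Isometry ι ∧ DenseRange ι ∧
        ∀ f : C(StoneCech X, ℝ),
          ι (algebraMap C(X, ℝ) (FGL.Q X) (f.comp ⟨stoneCechUnit, continuous_stoneCechUnit⟩)) =
            algebraMap C(StoneCech X, ℝ) (FGL.QBar X) f) ∧
    -- the completion is rationally complete
    FGL.IsRationallyComplete.{u, v} (FGL.QBar X) ∧
    -- it is the maximal ring of quotients of its subring of bounded functions
    Nonempty (FGL.MaxQuot (FGL.QBarStar X) ≃ₐ[FGL.QBarStar X] FGL.QBar X) ∧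
    -- the bounded part of that maximal ring of quotients is that subring
    (∀ q : FGL.MaxQuot (FGL.QBarStar X), FGL.IsBoundedQuotient q ↔
      q ∈ Set.range (algebraMap (FGL.QBarStar X) (FGL.MaxQuot (FGL.QBarStar X)))) :=
  mainTheorem4_general isDenseInducing_stoneCechUnit
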